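/- All graphs and posets are finite, and graphs are simple and undirected. A graph $H$ is a depth-$r$ minor of a graph $G$ if $H$ is isomorphic to a subgraph of the graph $G/\mathcal{X}$ obtained by contracting each part of some partition $\mathcal{X}$ of $V(G)$ into non-empty parts inducing connected subgraphs of radius at most $r$. Let $\nabla_r(G)$ be the maximum of $|E(H)|/|V(H)|$ over all non-empty depth-$r$ minors $H$ of $G$ (and $0$ if $G$ has no vertices). A class $\mathcal{C}$ of graphs has bounded expansion if there is a function $f$ such that $\nabla_r(G)\le f(r)$ for every integer $r\ge 0$ and every $G\in\mathcal{C}$. The height of a poset $P$ is the maximum size of a chain in $P$. The cover graph of $P$ is the graph on the points of $P$ whose edges are the pairs $\{x,y\}$ such that $x<y$ in $P$ and no $z$ satisfies $x<z<y$. The dimension $\dim(P)$ is the least positive integer $d$ such that there are $d$ linear extensions of $P$ whose intersection is $P$. **Theorem.** For every class $\mathcal{C}$ of graphs with bounded expansion and every integer $h\ge 1$, there is an integer $d$ such that every poset $P$ of height $h$ whose cover graph is in $\mathcal{C}$ satisfies $\dim(P)\le d$. -/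

import Mathlib

universe u v

/-! ### Posets -/

/-- `L` is a linear extension of the poset `P`. -/
def IsLinearExtension (P : Type u) [PartialOrder P] (L : P → P → Prop) : Prop :=
  IsLinearOrder P L ∧ ∀ x y : P, x ≤ y → L x y

/-- `L₁, …, L_d` is a realizer of `P`: a family of linear extensions whose intersection is `P`. -/
def IsRealizer (P : Type u) [PartialOrder P] {d : ℕ} (L : Fin d → P → P → Prop) : Prop :=
  (∀ i, IsLinearExtension P (L i)) ∧ ∀ x y : P, x ≤ y ↔ ∀ i, L i x y

/-- The dimension of a poset: the least positive `d` such that there is a realizer of size `d`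
(and `⊤` if there were none). In particular chains have dimension `1`. -/
noncomputable def posetDim (P : Type u) [PartialOrder P] : ℕ∞ :=
  ⨅ d ∈ {d : ℕ | 0 < d ∧ ∃ L : Fin d → P → P → Prop, IsRealizer P L}, (d : ℕ∞)

/-- The height of a poset: the maximum number of points in a chain. -/
noncomputable def posetHeight (P : Type u) [PartialOrder P] : ℕ∞ :=
  (Set.univ : Set P).chainHeight (· ≤ ·)

/-- The cover graph of a poset: its edges are the cover relations. -/
abbrev coverGraph (P : Type u) [PartialOrder P] : SimpleGraph P :=
  SimpleGraph.hasse P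

/-! ### Graph classes with bounded expansion -/

/-- A class of graphs. Only its finite members matter below. -/
abbrev GraphClass := ∀ V : Type u, SimpleGraph V → Prop

/-- Every part of the partition of `V` given by the equivalence relation `s` induces a (connected)
subgraph of `G` of radius at most `r`. -/
def PartsHaveRadiusLE {V : Type u} (G : SimpleGraph V) (s : Setoid V) (r : ℕ) : Prop :=
  ∀ X ∈ s.classes, (G.induce X).radius ≤ (r : ℕ∞)

/-- The quotient of `G` by a partition: the vertices are the parts, and two distinct parts are
adjacent when some edge of `G` joins them. -/
def quotientGraph {V : Type u} (G : SimpleGraph V) (s : Setoid V) : SimpleGraph (Quotient s) :=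
  G.map (Quotient.mk s)

/-- `H` is a depth-`r` minor of `G`: it is isomorphic to a subgraph of the quotient of `G` by some
partition of its vertices into parts inducing subgraphs of radius at most `r`. -/
def IsDepthMinor {W : Type v} {V : Type u} (r : ℕ) (H : SimpleGraph W) (G : SimpleGraph V) :
    Prop :=
  ∃ s : Setoid V, PartsHaveRadiusLE G s r ∧ H.IsContained (quotientGraph G s)

/-- The densities `|E(H)| / |V(H)|` of the nonempty depth-`r` minors `H` of a finite graph `G`. -/
def minorDensities {V : Type u} (G : SimpleGraph V) (r : ℕ) : Set ℝ :=
  {x | ∃ (n : ℕ) (H : SimpleGraph (Fin n)), 0 < n ∧ IsDepthMinor r H G ∧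
    x = (H.edgeSet.ncard : ℝ) / (n : ℝ)}

/-- The greatest reduced average density of rank `r` of a finite graph `G`. -/
noncomputable def grad {V : Type u} (G : SimpleGraph V) (r : ℕ) : ℝ :=
  sSup (minorDensities G r)

/-- A finite graph has only finitely many minor densities, so the supremum defining `grad` is a
maximum as soon as there is a vertex. -/
theorem minorDensities_finite {V : Type u} [Finite V] (G : SimpleGraph V) (r : ℕ) :
    (minorDensities G r).Finite := by
  have hfin : (⋃ n ∈ Set.Iic (Nat.card V), Set.range
      (fun H : SimpleGraph (Fin n) => (H.edgeSet.ncard : ℝ) / (n : ℝ))).Finite :=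
    (Set.finite_Iic _).biUnion fun n _ => Set.finite_range _
  refine hfin.subset ?_
  rintro x ⟨n, H, -, ⟨s, -, ⟨f⟩⟩, rfl⟩
  have h1 : Nat.card (Fin n) ≤ Nat.card (Quotient s) :=
    Nat.card_le_card_of_injective f f.injective
  have h2 : Nat.card (Quotient s) ≤ Nat.card V :=
    Nat.card_le_card_of_surjective _ Quotient.mk_surjective
  rw [Nat.card_fin] at h1
  exact Set.mem_biUnion (Set.mem_Iic.mpr (h1.trans h2)) ⟨H, rfl⟩

/-- A class of finite graphs has bounded expansion if, for every `r`, the greatest reduced average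
density of rank `r` of its members is bounded by a function of `r`. -/
def HasBoundedExpansion (C : GraphClass.{u}) : Prop :=
  ∃ f : ℕ → ℝ, ∀ (r : ℕ) (V : Type u) [Finite V] (G : SimpleGraph V), C V G → grad G r ≤ f r

/-! Sparsity yields a vertex order with small weak reachability sets, and colouring along this order
encodes each incomparability in boundedly many signatures.

For the order, `exists_small_hitting_set` finds in any nonempty set `S` a vertex whose short walks
to the rest of `S` are hit by few vertices. If every hitting set were large, contracting disjoint
neighbourhoods of an independent set in a maximal shallow minor on `S` would give too dense a
shallow minor. Placing such vertices last, one after another, bounds weak reachability, so a greedy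
colouring with boundedly many colours separates each vertex from all others weakly reachable from
it.

For the dimension, a relation `a ≤ b` is witnessed by a cover walk with at most `h - 1` edges, whose
least vertex is weakly reachable from both ends. The signature of `a ≰ b` records, for each colour,
whether `a` reaches a point above it and `b` a point below it, and which comes first. An alternating
cycle with constant signature, seen in the colour of the least walk minimum, would descend forever
(`posetDim_le_of_weakReach_coloring`). So each signature class is reversed by one linear extension.
-/

/-! ### Shallow minors and their models -/

/-- If `f` picks representatives of parts of radius at most `r`, a graph on representatives whose
edges come from edges of `G` between the parts has at most `c` edges per vertex. -/
theorem ncard_edgeSet_le_of_shallow_fibers {V : Type u} [Finite V] {G : SimpleGraph V} {r c : ℕ}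
    (hG : grad G r ≤ c) (f : V → V)
    (hf : ∀ w, ∃ p : G.Walk (f w) w, p.length ≤ r ∧ ∀ x ∈ p.support, f x = f w)
    (A : Finset V) (hA : ∀ x ∈ A, f x = x) (H : SimpleGraph V)
    (hH : ∀ x y, H.Adj x y → x ∈ A ∧ y ∈ A ∧ ∃ a b, f a = x ∧ f b = y ∧ G.Adj a b) :
    H.edgeSet.ncard ≤ c * A.card := by
  classical
  let e : Fin A.card ≃ A := A.equivFin.symm
  let g : Fin A.card → V := fun i => (e i : V)
  have hg : Function.Injective g := Subtype.val_injective.comp e.injective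
  have hgA : ∀ i, g i ∈ A := fun i => (e i).2
  have hsurj : ∀ x ∈ A, ∃ i, g i = x := fun x hx => ⟨e.symm ⟨x, hx⟩, by simp [g]⟩
  let K : SimpleGraph (Fin A.card) := H.comap g
  have hsub : H.edgeSet ⊆ Sym2.map g '' K.edgeSet := by
    intro z
    induction z with
    | _ x y =>
      intro h
      rw [SimpleGraph.mem_edgeSet] at h
      obtain ⟨hx, hy, -⟩ := hH x y h
      obtain ⟨i, rfl⟩ := hsurj x hx
      obtain ⟨j, rfl⟩ := hsurj y hy
      exact ⟨s(i, j), h, rfl⟩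
  have hle : H.edgeSet.ncard ≤ K.edgeSet.ncard :=
    (Set.ncard_le_ncard hsub (Set.toFinite _)).trans (Set.ncard_image_le (Set.toFinite _))
  rcases Nat.eq_zero_or_pos A.card with h0 | hpos
  · have hA0 : A = ∅ := Finset.card_eq_zero.mp h0
    have : H.edgeSet = ∅ := by
      apply Set.eq_empty_of_forall_notMem
      intro z
      induction z with
      | _ x y =>
        intro h
        have := (hH x y h).1
        simp [hA0] at this
    simp [this]
  -- The parts are the fibres of `f`, with centre `f w`; the given walks stay inside their fibre.
  have hparts : PartsHaveRadiusLE G (Setoid.ker f) r := by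
    rintro X ⟨w, rfl⟩
    obtain ⟨p, -, hp⟩ := hf w
    have hfw : f (f w) = f w := hp _ p.start_mem_support
    let x0 : {x | (Setoid.ker f) x w} := ⟨f w, hfw⟩
    refine (SimpleGraph.radius_le_eccent (u := x0)).trans ?_
    refine iSup_le ?_
    rintro ⟨y, hy⟩
    have hy' : f y = f w := hy
    obtain ⟨q, hql, hq⟩ := hf y
    let q' : G.Walk (f w) y := q.copy hy' rfl
    have hq' : ∀ x ∈ q'.support, x ∈ {x | (Setoid.ker f) x w} := by
      intro x hx
      have : x ∈ q.support := by simpa [q'] using hx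
      exact (hq x this).trans hy'
    refine (SimpleGraph.Walk.edist_le (q'.induce _ hq')).trans ?_
    have : (q'.induce _ hq').length ≤ r := by
      rw [← SimpleGraph.Walk.length_map (SimpleGraph.Embedding.induce _).toHom,
        SimpleGraph.Walk.map_induce]
      simpa [q'] using hql
    exact_mod_cast this
  have hcont : K.IsContained (quotientGraph G (Setoid.ker f)) := by
    refine ⟨⟨⟨fun i => Quotient.mk _ (g i), ?_⟩, ?_⟩⟩
    · intro i j hij
      have hij' : H.Adj (g i) (g j) := hij
      obtain ⟨-, -, a, b, ha, hb, hab⟩ := hH _ _ hij'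
      have h1 : Quotient.mk (Setoid.ker f) a = Quotient.mk _ (g i) :=
        Quotient.sound (show f a = f (g i) by rw [ha, hA _ (hgA i)])
      have h2 : Quotient.mk (Setoid.ker f) b = Quotient.mk _ (g j) :=
        Quotient.sound (show f b = f (g j) by rw [hb, hA _ (hgA j)])
      have hne : Quotient.mk (Setoid.ker f) a ≠ Quotient.mk _ b := by
        intro h
        have : f a = f b := Quotient.exact h
        exact hij'.ne (by rw [← ha, ← hb, this])
      rw [← h1, ← h2]
      exact ⟨hne, a, b, hab, rfl, rfl⟩
    · intro i j hij
      have : f (g i) = f (g j) := Quotient.exact hij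
      rw [hA _ (hgA i), hA _ (hgA j)] at this
      exact hg this
  have hmem : (K.edgeSet.ncard : ℝ) / (A.card : ℝ) ∈ minorDensities G r :=
    ⟨A.card, K, hpos, ⟨_, hparts, hcont⟩, rfl⟩
  have h1 := (le_csSup (minorDensities_finite G r).bddAbove hmem).trans hG
  rw [div_le_iff₀ (by exact_mod_cast hpos)] at h1
  exact hle.trans (by exact_mod_cast h1)

/-- A walk from outside of `B` into `B` has an initial segment that avoids `B` and ends at a neighbour
of a vertex of `B` on the walk. -/
theorem SimpleGraph.Walk.exists_adj_first_mem {V : Type u} {G : SimpleGraph V} (B : Set V)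
    {a b : V} (p : G.Walk a b) (ha : a ∉ B) (hb : b ∈ B) :
    ∃ x y, ∃ q : G.Walk a x, G.Adj x y ∧ y ∈ B ∧ y ∈ p.support ∧ q.length < p.length ∧
      ∀ z ∈ q.support, z ∈ p.support ∧ z ∉ B := by
  induction p with
  | nil => exact absurd hb ha
  | @cons a c b h p ih =>
    by_cases hc : c ∈ B
    · exact ⟨a, c, .nil, h, hc, by simp, by simp, by simpa using ha⟩
    · obtain ⟨x, y, q, hxy, hy, hyp, hl, hq⟩ := ih hc hb
      refine ⟨x, y, .cons h q, hxy, hy, by simp [hyp], by simpa using hl, ?_⟩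
      intro z hz
      rw [SimpleGraph.Walk.support_cons, List.mem_cons] at hz
      rcases hz with rfl | hz
      · exact ⟨by simp, ha⟩
      · exact ⟨by simp [(hq z hz).1], (hq z hz).2⟩

/-- A shallow minor model on the vertex set `S`: the graph `H` on `S` is obtained from `G` by
contracting the fibres of `f`, which have radius at most `r` and are singletons outside of `M`. -/
structure IsShallowModel {V : Type u} (G : SimpleGraph V) (S : Finset V) (r : ℕ)
    (H : SimpleGraph V) (M : Finset V) (f : V → V) : Prop where
  subset : S ⊆ M
  map_self : ∀ x ∈ S, f x = x
  map_mem : ∀ x ∈ M, f x ∈ S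
  map_of_notMem : ∀ x ∉ M, f x = x
  radius_le : ∀ w, ∃ p : G.Walk (f w) w, p.length ≤ r ∧ ∀ x ∈ p.support, f x = f w
  exists_adj : ∀ x y, H.Adj x y → x ∈ S ∧ y ∈ S ∧ ∃ a b, f a = x ∧ f b = y ∧ G.Adj a b
  card_le : M.card ≤ S.card + r * H.edgeSet.ncard

theorem IsShallowModel.bot {V : Type u} (G : SimpleGraph V) (S : Finset V) (r : ℕ) :
    IsShallowModel G S r ⊥ S id :=
  ⟨subset_rfl, fun _ _ => rfl, fun _ h => h, fun _ _ => rfl,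
    fun w => ⟨.nil, by simp, by simp⟩, fun _ _ h => h.elim, by simp⟩

/-- A model is enlarged along a short walk outside of it between two non-adjacent branch sets. -/
theorem IsShallowModel.exists_sup_edge {V : Type u} [Finite V] {G : SimpleGraph V} {S : Finset V}
    {r : ℕ} {H : SimpleGraph V} {M : Finset V} {f : V → V} (hm : IsShallowModel G S r H M f)
    {u v x : V} (hu : u ∈ S) (hv : v ∈ S) (huv : u ≠ v) (hH : ¬ H.Adj u v) (p : G.Walk u x)
    (hp : p.length ≤ r) (hpM : ∀ z ∈ p.support, z = u ∨ z ∉ M) (hxv : G.Adj x v) :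
    ∃ M' f', IsShallowModel G S r (H ⊔ SimpleGraph.edge u v) M' f' := by
  classical
  have hvp : v ∉ p.support := fun h =>
    (hpM v h).elim (fun h => huv h.symm) (fun h => h (hm.subset hv))
  have hfp : ∀ z ∈ p.support, f z = z := fun z hz =>
    (hpM z hz).elim (fun h => h ▸ hm.map_self u hu) (hm.map_of_notMem z)
  have hfS : ∀ a, f a ∈ S → a ∈ p.support → a = u := by
    intro a ha hap
    rw [hfp a hap] at ha
    exact (hpM a hap).resolve_right (not_not_intro (hm.subset ha))
  let f' : V → V := fun w => if w ∈ p.support then u else f w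
  have hf'p : ∀ w ∈ p.support, f' w = u := fun w hw => if_pos hw
  have hf'n : ∀ w ∉ p.support, f' w = f w := fun w hw => if_neg hw
  -- Apart from `u`, the walk only absorbs singleton fibres outside `M`, so the old branch sets
  -- survive. Every absorbed walk starts at `u` itself, so the radius does not accumulate.
  have hf'S : ∀ a, f a ∈ S → f' a = f a := by
    intro a ha
    by_cases hap : a ∈ p.support
    · rw [hf'p a hap, hfS a ha hap, hm.map_self u hu]
    · exact hf'n a hap
  refine ⟨M ∪ p.support.tail.toFinset, f', ?_, ?_, ?_, ?_, ?_, ?_, ?_⟩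
  · exact hm.subset.trans Finset.subset_union_left
  · intro a ha
    rw [hf'S a ((hm.map_self a ha).symm ▸ ha), hm.map_self a ha]
  · intro a ha
    by_cases hap : a ∈ p.support
    · rw [hf'p a hap]; exact hu
    · rw [hf'n a hap]
      rcases Finset.mem_union.1 ha with h | h
      · exact hm.map_mem a h
      · exact absurd (List.mem_of_mem_tail (List.mem_toFinset.1 h)) hap
  · intro a ha
    rw [Finset.mem_union, not_or, List.mem_toFinset] at ha
    have hap : a ∉ p.support := by
      rw [SimpleGraph.Walk.mem_support_iff]
      rintro (rfl | h)
      · exact ha.1 (hm.subset hu)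
      · exact ha.2 h
    rw [hf'n a hap, hm.map_of_notMem a ha.1]
  · intro w
    by_cases hw : w ∈ p.support
    · refine ⟨(p.takeUntil w hw).copy (hf'p w hw).symm rfl, ?_, ?_⟩
      · rw [SimpleGraph.Walk.length_copy]
        exact (p.length_takeUntil_le_length hw).trans hp
      · intro z hz
        rw [SimpleGraph.Walk.support_copy] at hz
        rw [hf'p w hw, hf'p z (p.support_takeUntil_subset_support hw hz)]
    · obtain ⟨q, hq, hqf⟩ := hm.radius_le w
      refine ⟨q.copy (hf'n w hw).symm rfl, by simpa using hq, ?_⟩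
      intro z hz
      rw [SimpleGraph.Walk.support_copy] at hz
      rw [hf'n w hw, ← hqf z hz]
      by_cases hwM : w ∈ M
      · exact hf'S z (hqf z hz ▸ hm.map_mem w hwM)
      · refine hf'n z fun hzp => hw ?_
        rw [← hm.map_of_notMem w hwM, ← hqf z hz, hfp z hzp]
        exact hzp
  · intro a b hab
    rcases hab with hab | hab
    · obtain ⟨ha, hb, a', b', rfl, rfl, h⟩ := hm.exists_adj a b hab
      exact ⟨ha, hb, a', b', hf'S a' ha, hf'S b' hb, h⟩
    · have hvv : f' v = v := by rw [hf'n v hvp, hm.map_self v hv]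
      have hxu : f' x = u := hf'p x p.end_mem_support
      rcases (SimpleGraph.edge_adj ..).1 hab with ⟨⟨rfl, rfl⟩ | ⟨rfl, rfl⟩, -⟩
      · exact ⟨hu, hv, x, _, hxu, hvv, hxv⟩
      · exact ⟨hv, hu, _, x, hvv, hxu, hxv.symm⟩
  · have h1 : (H ⊔ SimpleGraph.edge u v).edgeSet.ncard = H.edgeSet.ncard + 1 := by
      rw [SimpleGraph.edgeSet_sup, SimpleGraph.edgeSet_edge_of_ne huv, Set.union_singleton,
        Set.ncard_insert_of_notMem (by simpa using hH) (Set.toFinite _)]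
    -- The start `u` already lies in `M`, so one new edge costs at most `r` new vertices.
    have h2 : p.support.tail.toFinset.card ≤ r := by
      refine (List.toFinset_card_le _).trans ?_
      rw [List.length_tail, SimpleGraph.Walk.length_support]
      omega
    have h3 := Finset.card_union_le M p.support.tail.toFinset
    have h4 := hm.card_le
    rw [h1, mul_add, mul_one]
    omega

/-! ### Large independent sets -/

/-- A graph with at most `c` edges per vertex of `S` has a large independent subset of `S`. -/
theorem exists_isIndepSet_of_ncard_edgeSet_le {V : Type u} [Finite V] (H : SimpleGraph V)
    (S : Finset V) (c : ℕ) (hc : H.edgeSet.ncard ≤ c * S.card) :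
    ∃ I ⊆ S, (∀ u ∈ I, ∀ v ∈ I, ¬ H.Adj u v) ∧ S.card ≤ 2 * (4 * c + 1) * I.card := by
  classical
  have := Fintype.ofFinite V
  let L : Finset V := {v ∈ S | H.degree v ≤ 4 * c}
  have hdeg : ∑ v ∈ S, H.degree v ≤ 2 * (c * S.card) := by
    refine (Finset.sum_le_univ_sum_of_nonneg fun _ => Nat.zero_le _).trans ?_
    rw [H.sum_degrees_eq_twice_card_edges]
    have : H.edgeFinset.card = H.edgeSet.ncard := by
      rw [← SimpleGraph.coe_edgeFinset, Set.ncard_coe_finset]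
    omega
  -- The average degree on `S` is at most `2 * c`, so at most half of `S` has degree above `4 * c`.
  have hL : S.card ≤ 2 * L.card := by
    let B : Finset V := {v ∈ S | ¬ H.degree v ≤ 4 * c}
    have h1 : L.card + B.card = S.card := Finset.card_filter_add_card_filter_not _
    have h2 : B.card * (4 * c + 1) ≤ ∑ v ∈ S, H.degree v := by
      refine le_trans ?_ (Finset.sum_le_sum_of_subset (Finset.filter_subset _ S : B ⊆ S))
      rw [← smul_eq_mul]
      refine Finset.card_nsmul_le_sum _ _ _ fun v hv => ?_
      have := (Finset.mem_filter.1 hv).2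
      omega
    nlinarith
  have hne : ((L.powerset.filter fun I => ∀ u ∈ I, ∀ v ∈ I, ¬ H.Adj u v)).Nonempty :=
    ⟨∅, by simp⟩
  obtain ⟨I, hI⟩ := Finset.exists_maximal hne
  have hI1 : I ∈ L.powerset.filter fun I => ∀ u ∈ I, ∀ v ∈ I, ¬ H.Adj u v := hI.1
  rw [Finset.mem_filter, Finset.mem_powerset] at hI1
  -- A maximal independent set dominates, and each of its vertices covers at most `4 * c + 1`
  -- vertices.
  have hdom : L ⊆ I.biUnion fun v => insert v (H.neighborFinset v) := by
    intro w hw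
    by_contra hcon
    simp only [Finset.mem_biUnion, Finset.mem_insert, SimpleGraph.mem_neighborFinset, not_exists,
      not_and, not_or] at hcon
    have hwI : w ∉ I := fun h => (hcon w h).1 rfl
    have hins : insert w I ∈ L.powerset.filter fun I => ∀ u ∈ I, ∀ v ∈ I, ¬ H.Adj u v := by
      rw [Finset.mem_filter, Finset.mem_powerset]
      refine ⟨Finset.insert_subset hw hI1.1, ?_⟩
      intro a ha b hb hab
      rcases Finset.mem_insert.1 ha with rfl | ha' <;> rcases Finset.mem_insert.1 hb with rfl | hb'
      · exact hab.ne rfl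
      · exact (hcon b hb').2 hab.symm
      · exact (hcon a ha').2 hab
      · exact hI1.2 a ha' b hb' hab
    have := hI.2 hins (Finset.subset_insert _ _)
    exact hwI (this (Finset.mem_insert_self _ _))
  have hcard : L.card ≤ I.card * (4 * c + 1) := by
    refine (Finset.card_le_card hdom).trans (Finset.card_biUnion_le_card_mul _ _ _ fun v hv => ?_)
    refine (Finset.card_insert_le _ _).trans ?_
    rw [SimpleGraph.card_neighborFinset_eq_degree]
    have := (Finset.mem_filter.1 (hI1.1 hv)).2
    omega
  exact ⟨I, hI1.1.trans (Finset.filter_subset _ _), hI1.2, by nlinarith⟩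

/-! ### Vertex orders, weak reachability and colouring -/

/-- Eliminating one vertex at a time from the remaining set yields a linear order. -/
theorem exists_injective_of_exists_last {V : Type u} [Finite V] (Q : V → Set V → Prop)
    (hQ : ∀ S : Finset V, S.Nonempty → ∃ v ∈ S, Q v (↑S \ {v})) :
    ∃ π : V → ℕ, Function.Injective π ∧ ∀ v, Q v {u | π u < π v} := by
  classical
  have key : ∀ n, ∀ S : Finset V, S.card = n →
      ∃ π : V → ℕ, Set.InjOn π S ∧ (∀ v ∈ S, π v < n) ∧ ∀ v ∈ S, Q v {u ∈ S | π u < π v} := by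
    intro n
    induction n with
    | zero =>
      intro S hS
      rw [Finset.card_eq_zero] at hS
      subst hS
      exact ⟨fun _ => 0, by simp⟩
    | succ n ih =>
      intro S hS
      obtain ⟨v, hv, hQv⟩ := hQ S (Finset.card_pos.1 (by omega))
      obtain ⟨π, hinj, hlt, hπ⟩ := ih (S.erase v) (by rw [Finset.card_erase_of_mem hv, hS]; rfl)
      have hself : Function.update π v n v = n := Function.update_self ..
      have hne : ∀ x, x ≠ v → Function.update π v n x = π x :=
        fun x hx => Function.update_of_ne hx ..
      refine ⟨Function.update π v n, ?_, ?_, ?_⟩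
      · intro x hx y hy hxy
        by_cases hxv : x = v
        · by_cases hyv : y = v
          · rw [hxv, hyv]
          · rw [hxv, hself, hne y hyv] at hxy
            exact absurd (hlt y (Finset.mem_erase.2 ⟨hyv, hy⟩)) (by omega)
        · by_cases hyv : y = v
          · rw [hyv, hself, hne x hxv] at hxy
            exact absurd (hlt x (Finset.mem_erase.2 ⟨hxv, hx⟩)) (by omega)
          · rw [hne x hxv, hne y hyv] at hxy
            exact hinj (Finset.mem_coe.2 (Finset.mem_erase.2 ⟨hxv, hx⟩))
              (Finset.mem_coe.2 (Finset.mem_erase.2 ⟨hyv, hy⟩)) hxy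
      · intro x hx
        by_cases hxv : x = v
        · rw [hxv, hself]; omega
        · rw [hne x hxv]
          have := hlt x (Finset.mem_erase.2 ⟨hxv, hx⟩)
          omega
      · intro x hx
        by_cases hxv : x = v
        · subst hxv
          convert hQv using 1
          ext y
          simp only [Set.mem_ofPred_eq, Set.mem_sdiff, Finset.mem_coe, Set.mem_singleton_iff, hself]
          refine and_congr_right fun hy => ?_
          by_cases hyx : y = x
          · simp [hyx]
          · simpa [hne y hyx, hyx] using hlt y (Finset.mem_erase.2 ⟨hyx, hy⟩)
        · have hx' := Finset.mem_erase.2 ⟨hxv, hx⟩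
          convert hπ x hx' using 1
          ext y
          simp only [Set.mem_ofPred_eq, hne x hxv, Finset.mem_erase]
          by_cases hyv : y = v
          · have := hlt x hx'
            simp only [hyv, hself, ne_eq, not_true_eq_false, false_and, iff_false, not_and]
            omega
          · simp [hyv]
  have := Fintype.ofFinite V
  obtain ⟨π, h1, -, h3⟩ := key _ Finset.univ rfl
  exact ⟨π, by simpa using h1, fun v => by simpa using h3 v (Finset.mem_univ v)⟩

/-- The vertices weakly `n`-reachable from `v` with respect to the order given by `π`. -/
def weakReach {V : Type u} (G : SimpleGraph V) (π : V → ℕ) (n : ℕ) (v : V) : Set V :=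
  {u | ∃ p : G.Walk v u, p.length ≤ n ∧ ∀ w ∈ p.support, π u ≤ π w}

/-- If few vertices hit all walks of length at most `R` from a vertex to smaller ones, then weak
reachability sets are small. -/
theorem ncard_weakReach_le {V : Type u} [Finite V] {G : SimpleGraph V} {π : V → ℕ}
    (hπ : Function.Injective π) {R N : ℕ}
    (hX : ∀ v, ∃ X : Finset V, X.card ≤ N ∧ v ∉ X ∧ ∀ u, π u < π v → ∀ p : G.Walk v u,
      p.length ≤ R → ∃ x ∈ X, x ∈ p.support) (n : ℕ) (hn : n ≤ R) (v : V) :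
    (weakReach G π n v).ncard ≤ ∑ i ∈ Finset.range (n + 1), N ^ i := by
  classical
  induction n generalizing v with
  | zero =>
    have : weakReach G π 0 v ⊆ {v} := by
      rintro u ⟨p, hp, -⟩
      exact (SimpleGraph.Walk.eq_of_length_eq_zero (Nat.le_zero.1 hp)).symm
    simpa using Set.ncard_le_ncard this
  | succ n ih =>
    obtain ⟨X, hXc, hvX, hX⟩ := hX v
    -- A walk to a smaller vertex meets `X` at some `x ≠ v`; its remainder is strictly shorter and
    -- still has `u` as its minimum.
    have hsub : weakReach G π (n + 1) v ⊆ {v} ∪ ⋃ x ∈ X, weakReach G π n x := by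
      rintro u ⟨p, hp, hmin⟩
      rcases (hmin v p.start_mem_support).eq_or_lt with h | h
      · exact Or.inl (hπ h)
      · obtain ⟨x, hx, hxp⟩ := hX u h p (hp.trans hn)
        refine Or.inr (Set.mem_biUnion hx ⟨p.dropUntil x hxp, ?_, ?_⟩)
        · have := SimpleGraph.Walk.length_dropUntil_lt_length hxp (fun e => hvX (e ▸ hx))
          omega
        · exact fun w hw => hmin w (p.support_dropUntil_subset_support hxp hw)
    have h2 : (⋃ x ∈ X, weakReach G π n x).ncard ≤ ∑ x ∈ X, (weakReach G π n x).ncard :=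
      Finset.set_ncard_biUnion_le _ _
    calc (weakReach G π (n + 1) v).ncard
        ≤ ({v} ∪ ⋃ x ∈ X, weakReach G π n x).ncard := Set.ncard_le_ncard hsub
      _ ≤ 1 + ∑ x ∈ X, (weakReach G π n x).ncard := by
        refine (Set.ncard_union_le _ _).trans ?_
        rw [Set.ncard_singleton]; omega
      _ ≤ 1 + ∑ _x ∈ X, ∑ i ∈ Finset.range (n + 1), N ^ i := by
        gcongr with x hx; exact ih (by omega) x
      _ ≤ 1 + N * ∑ i ∈ Finset.range (n + 1), N ^ i := by
        rw [Finset.sum_const, smul_eq_mul]; gcongr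
      _ = ∑ i ∈ Finset.range (n + 1 + 1), N ^ i := by
        rw [Finset.sum_range_succ' _ (n + 1), Finset.mul_sum, add_comm]
        simp [pow_succ, mul_comm]

/-- Greedy colouring: if every vertex has to differ from few smaller vertices only, few colours
suffice. -/
theorem exists_greedy_coloring {V : Type u} [Finite V] (π : V → ℕ) (B : V → Set V) {D : ℕ}
    (hB : ∀ v, (B v).ncard ≤ D) :
    ∃ φ : V → Fin (D + 1), ∀ v, ∀ u ∈ B v, π u < π v → φ u ≠ φ v := by
  classical
  have hex : ∀ v (φ : ∀ u, π u < π v → Fin (D + 1)),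
      ∃ c, ∀ u (hu : π u < π v), u ∈ B v → φ u hu ≠ c := by
    intro v φ
    by_contra! hcon
    choose g hg hgB hgc using hcon
    have hinj : Function.Injective g := fun c d hcd => by
      rw [← hgc c, ← hgc d]; congr 1
    have h1 : (Set.range g).ncard = D + 1 := by
      rw [← Set.image_univ, Set.ncard_image_of_injective _ hinj, Set.ncard_univ, Nat.card_fin]
    have h2 : (Set.range g).ncard ≤ (B v).ncard :=
      Set.ncard_le_ncard (Set.range_subset_iff.2 hgB) (Set.toFinite _)
    have := hB v
    omega
  choose col hcol using hex
  let wf : WellFounded fun u v : V => π u < π v := (measure π).wf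
  refine ⟨wf.fix fun v φ => col v φ, fun v u hu huv => ?_⟩
  rw [wf.fix_eq _ v]
  exact hcol v (fun u _ => wf.fix (fun v φ => col v φ) u) u huv hu

/-! ### Linear extensions and alternating cycles -/

/-- A set of pairs `(a, b)` with `a ≰ b` is reversed by one linear extension as soon as it contains
no alternating cycle. -/
theorem exists_linearExtension_reversing {P : Type u} [PartialOrder P] (I : Set (P × P))
    (hI : ∀ C ⊆ I, C.Nonempty → (∀ e ∈ C, ∃ e' ∈ C, e.1 ≤ e'.2) →
      (∀ e ∈ C, ∃ e' ∈ C, e'.1 ≤ e.2) → False) :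
    ∃ L : P → P → Prop, IsLinearExtension P L ∧ ∀ e ∈ I, L e.2 e.1 := by
  let T : P × P → P × P → Prop := fun e e' => e ∈ I ∧ e' ∈ I ∧ e.1 ≤ e'.2
  have hT : ∀ e, ¬ Relation.TransGen T e e := by
    intro e0 h0
    -- The strongly connected component of `e0` is closed under choosing some successor and some
    -- predecessor.
    refine hI {e | Relation.TransGen T e e0 ∧ Relation.TransGen T e0 e} ?_ ⟨e0, h0, h0⟩ ?_ ?_
    · rintro e ⟨h, -⟩
      obtain ⟨e', h', -⟩ := Relation.TransGen.head'_iff.1 h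
      exact h'.1
    · rintro e ⟨h, h2⟩
      obtain ⟨e', h', h''⟩ := Relation.TransGen.head'_iff.1 h
      refine ⟨e', ⟨?_, h2.tail h'⟩, h'.2.2⟩
      rcases Relation.reflTransGen_iff_eq_or_transGen.1 h'' with rfl | h3
      · exact h0
      · exact h3
    · rintro e ⟨h, h2⟩
      obtain ⟨e', h'', h'⟩ := Relation.TransGen.tail'_iff.1 h2
      refine ⟨e', ⟨h.head h', ?_⟩, h'.2.2⟩
      rcases Relation.reflTransGen_iff_eq_or_transGen.1 h'' with rfl | h3
      · exact h0
      · exact h3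
  -- The transitive closure of the order together with the reversed pairs; acyclicity of `T` makes
  -- it antisymmetric.
  let r : P → P → Prop := fun x y =>
    x ≤ y ∨ ∃ e e', e ∈ I ∧ e' ∈ I ∧ x ≤ e.2 ∧ Relation.ReflTransGen T e e' ∧ e'.1 ≤ y
  have hr : IsPartialOrder P r :=
    { refl := fun x => Or.inl le_rfl
      trans := by
        rintro x y z (h | ⟨e, e', he, he', h1, h2, h3⟩) (k | ⟨d, d', hd, hd', k1, k2, k3⟩)
        · exact Or.inl (h.trans k)
        · exact Or.inr ⟨d, d', hd, hd', h.trans k1, k2, k3⟩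
        · exact Or.inr ⟨e, e', he, he', h1, h2, h3.trans k⟩
        · exact Or.inr ⟨e, d', he, hd', h1, (h2.tail ⟨he', hd, h3.trans k1⟩).trans k2, k3⟩
      antisymm := by
        rintro x y (h | ⟨e, e', he, he', h1, h2, h3⟩) (k | ⟨d, d', hd, hd', k1, k2, k3⟩)
        · exact le_antisymm h k
        · exact (hT d (Relation.TransGen.tail' k2 ⟨hd', hd, k3.trans (h.trans k1)⟩)).elim
        · exact (hT e (Relation.TransGen.tail' h2 ⟨he', he, h3.trans (k.trans h1)⟩)).elim
        · exact (hT e (Relation.TransGen.tail' ((h2.tail ⟨he', hd, h3.trans k1⟩).trans k2)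
            ⟨hd', he, k3.trans h1⟩)).elim }
  obtain ⟨L, hL, hrL⟩ := extend_partialOrder r
  exact ⟨L, ⟨hL, fun x y h => hrL x y (Or.inl h)⟩,
    fun e he => hrL _ _ (Or.inr ⟨e, e, he, he, le_rfl, .refl, le_rfl⟩)⟩

/-- Classes of pairs without alternating cycles yield a realizer. -/
theorem posetDim_le_card_of_classes {P : Type u} [PartialOrder P] {K : Type*} [Fintype K]
    [Nonempty K] (σ : P × P → K)
    (hσ : ∀ k, ∀ C ⊆ {e : P × P | ¬ e.1 ≤ e.2 ∧ σ e = k}, C.Nonempty →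
      (∀ e ∈ C, ∃ e' ∈ C, e.1 ≤ e'.2) → (∀ e ∈ C, ∃ e' ∈ C, e'.1 ≤ e.2) → False) :
    posetDim P ≤ (Fintype.card K : ℕ∞) := by
  choose L hL hrev using fun k => exists_linearExtension_reversing _ (hσ k)
  refine iInf₂_le _ ⟨Fintype.card_pos, fun i => L ((Fintype.equivFin K).symm i), ?_, ?_⟩
  · exact fun i => hL _
  · intro x y
    refine ⟨fun h i => (hL _).2 x y h, fun h => ?_⟩
    by_contra hxy
    have h1 := h (Fintype.equivFin K (σ (x, y)))
    simp only [Equiv.symm_apply_apply] at h1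
    have := (hL (σ (x, y))).1
    exact hxy (antisymm_of (L (σ (x, y))) h1 (hrev (σ (x, y)) (x, y) ⟨hxy, rfl⟩)).le

/-- Points `a ≤ b` of a poset are joined by a cover walk inside the interval which is shorter than
the height. -/
theorem exists_coverGraph_walk {P : Type u} [Finite P] [PartialOrder P] {h : ℕ}
    (hh : posetHeight P ≤ (h : ℕ∞)) {a b : P} (hab : a ≤ b) :
    ∃ p : (coverGraph P).Walk a b, p.length ≤ h - 1 ∧ ∀ x ∈ p.support, a ≤ x ∧ x ≤ b := by
  have key : ∀ a : P, a ≤ b → ∃ p : (coverGraph P).Walk a b,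
      p.support.Pairwise (· < ·) ∧ ∀ x ∈ p.support, a ≤ x ∧ x ≤ b := by
    intro a
    induction a using WellFoundedGT.induction with
    | _ a ih =>
      intro hab
      rcases hab.eq_or_lt with rfl | hlt
      · exact ⟨.nil, by simp, by simp⟩
      · obtain ⟨c, hac, hcb⟩ := exists_covBy_le_of_lt hlt
        obtain ⟨p, hp, hp'⟩ := ih c hac.lt hcb
        have hadj : (coverGraph P).Adj a c := SimpleGraph.hasse_adj.2 (Or.inl hac)
        refine ⟨.cons hadj p, ?_, ?_⟩
        · rw [SimpleGraph.Walk.support_cons, List.pairwise_cons]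
          exact ⟨fun x hx => hac.lt.trans_le (hp' x hx).1, hp⟩
        · intro x hx
          rw [SimpleGraph.Walk.support_cons, List.mem_cons] at hx
          rcases hx with rfl | hx
          · exact ⟨le_rfl, hab⟩
          · exact ⟨hac.le.trans (hp' x hx).1, (hp' x hx).2⟩
  obtain ⟨p, hp, hp'⟩ := key a hab
  refine ⟨p, ?_, hp'⟩
  classical
  have hchain : IsChain (· ≤ ·) (↑p.support.toFinset : Set P) := by
    intro x hx y hy hxy
    have hx' : x ∈ p.support := by simpa using hx
    have hy' : y ∈ p.support := by simpa using hy
    have : Std.Symm fun x y : P => x ≤ y ∨ y ≤ x := ⟨fun _ _ => Or.symm⟩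
    exact (hp.imp (S := fun x y => x ≤ y ∨ y ≤ x) fun h => Or.inl h.le).forall hx' hy' hxy
  have h1 := (Set.encard_le_chainHeight_of_isChain Set.univ _ (Set.subset_univ _) hchain).trans hh
  rw [Set.encard_coe_eq_coe_finsetCard, List.toFinset_card_of_nodup (hp.imp fun h => h.ne),
    SimpleGraph.Walk.length_support] at h1
  have : p.length + 1 ≤ h := by exact_mod_cast h1
  omega

/-! ### Small hitting sets from sparsity -/

/-- In a graph whose shallow minors are sparse, every nonempty vertex set `S` contains a vertex all
of whose short walks to other vertices of `S` are hit by few vertices. -/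
theorem exists_small_hitting_set {V : Type u} [Finite V] {G : SimpleGraph V} {R c : ℕ}
    (hG : grad G (2 * R) ≤ c) (S : Finset V) (hS : S.Nonempty) :
    ∃ v ∈ S, ∃ X : Finset V, X.card ≤ 2 * (4 * c + 1) * (c * (1 + 2 * R * c)) ∧ v ∉ X ∧
      ∀ u ∈ S, u ≠ v → ∀ p : G.Walk v u, p.length ≤ R → ∃ x ∈ X, x ∈ p.support := by
  classical
  have := Fintype.ofFinite V
  obtain ⟨H, hHmax⟩ := Set.Finite.exists_maximal
    (Set.toFinite {H : SimpleGraph V | ∃ M f, IsShallowModel G S (2 * R) H M f})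
    ⟨⊥, S, id, .bot G S (2 * R)⟩
  obtain ⟨M, f, hm⟩ := hHmax.1
  have hmax : ∀ u ∈ S, ∀ v ∈ S, u ≠ v → ¬ H.Adj u v → ∀ x, ∀ p : G.Walk u x, p.length ≤ 2 * R →
      (∀ z ∈ p.support, z = u ∨ z ∉ M) → ¬ G.Adj x v := by
    intro u hu v hv huv hH x p hp hpM hxv
    refine hH (hHmax.2 (hm.exists_sup_edge hu hv huv hH p hp hpM hxv) le_sup_left ?_)
    exact Or.inr ((SimpleGraph.edge_adj ..).2 ⟨Or.inl ⟨rfl, rfl⟩, huv⟩)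
  have hcH : H.edgeSet.ncard ≤ c * S.card :=
    ncard_edgeSet_le_of_shallow_fibers hG f hm.radius_le S hm.map_self H hm.exists_adj
  obtain ⟨I, hIS, hI, hIc⟩ := exists_isIndepSet_of_ncard_edgeSet_le H S c hcH
  let T : V → V → Prop := fun v y =>
    ∃ q : G.Walk v y, q.length ≤ R ∧ ∀ z ∈ q.support, z = v ∨ z ∉ M
  let X : V → Finset V := fun v => {x | x ∈ M ∧ x ≠ v ∧ ∃ y, T v y ∧ G.Adj y x}
  have hX : ∀ v x, x ∈ X v ↔ x ∈ M ∧ x ≠ v ∧ ∃ y, T v y ∧ G.Adj y x := by simp [X]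
  have hhit : ∀ v ∈ S, ∀ u ∈ S, u ≠ v → ∀ p : G.Walk v u, p.length ≤ R →
      ∃ x ∈ X v, x ∈ p.support := by
    intro v _ u hu huv p hp
    obtain ⟨y, x, q, hyx, hxB, hxp, hql, hq⟩ := p.exists_adj_first_mem {z | z ∈ M ∧ z ≠ v}
      (fun h => h.2 rfl) ⟨hm.subset hu, huv⟩
    refine ⟨x, (hX v x).2 ⟨hxB.1, hxB.2, y, ⟨q, by omega, fun z hz => ?_⟩, hyx⟩, hxp⟩
    have h2 : ¬ (z ∈ M ∧ z ≠ v) := (hq z hz).2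
    tauto
  by_contra hcon
  have hlarge : ∀ v ∈ S, 2 * (4 * c + 1) * (c * (1 + 2 * R * c)) < (X v).card := by
    intro v hv
    by_contra hle
    exact hcon ⟨v, hv, X v, not_lt.1 hle, fun h => ((hX v v).1 h).2.1 rfl, hhit v hv⟩
  -- Overlapping regions of two vertices of `I` would give a walk of length at most `2 * R` avoiding
  -- `M` in between, and thus a new edge of the maximal `H`. This is why models have radius `2 * R`.
  have huniq : ∀ u ∈ I, ∀ v ∈ I, ∀ y, T u y → T v y → u = v := by
    rintro u hu v hv y ⟨p, hp, hpM⟩ ⟨q, hq, hqM⟩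
    by_contra huv
    obtain ⟨a, b, w, hab, hb, -, hwl, hw⟩ := (p.append q.reverse).exists_adj_first_mem {v} huv rfl
    rw [SimpleGraph.Walk.length_append, SimpleGraph.Walk.length_reverse] at hwl
    obtain rfl : b = v := hb
    refine hmax u (hIS hu) b (hIS hv) huv (hI u hu b hv) a w (by omega) (fun z hz => ?_) hab
    obtain ⟨hz1, hz2⟩ := hw z hz
    rw [SimpleGraph.Walk.mem_support_append_iff, SimpleGraph.Walk.support_reverse,
      List.mem_reverse] at hz1
    rcases hz1 with h | h
    · exact hpM z h
    · exact Or.inr ((hqM z h).resolve_left hz2)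
  have hTself : ∀ v, T v v := fun v => ⟨.nil, by simp, by simp⟩
  let g : V → V := fun y => if h : ∃ v ∈ I, T v y then h.choose else y
  have hgT : ∀ v ∈ I, ∀ y, T v y → g y = v := by
    intro v hv y hy
    have h : ∃ v ∈ I, T v y := ⟨v, hv, hy⟩
    rw [show g y = h.choose from dif_pos h]
    exact huniq _ h.choose_spec.1 v hv y h.choose_spec.2 hy
  have hgN : ∀ y, (¬ ∃ v ∈ I, T v y) → g y = y := fun y hy => dif_neg hy
  have hgM : ∀ x ∈ M, g x = x := by
    intro x hx
    by_cases h : ∃ v ∈ I, T v x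
    · obtain ⟨v, hv, hvx⟩ := h
      rw [hgT v hv x hvx]
      obtain ⟨q, -, hq⟩ := hvx
      exact ((hq x q.end_mem_support).resolve_right (not_not_intro hx)).symm
    · exact hgN x h
  have hXI : ∀ v ∈ I, ∀ x ∈ X v, x ∉ I := by
    intro v hv x hx hxI
    obtain ⟨-, hxv, y, ⟨q, hql, hq⟩, hyx⟩ := (hX v x).1 hx
    exact hmax v (hIS hv) x (hIS hxI) hxv.symm (hI v hv x hxI) y q (by omega) hq hyx
  -- Contracting the disjoint regions `T v`, `v ∈ I`, joins each `v` to all of `X v`, giving a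
  -- shallow minor on `M`.
  let K : SimpleGraph V := SimpleGraph.fromRel fun a b => a ∈ I ∧ b ∈ X a
  have hKM : K.edgeSet.ncard ≤ c * M.card := by
    refine ncard_edgeSet_le_of_shallow_fibers hG g ?_ M hgM K ?_
    · intro w
      by_cases h : ∃ v ∈ I, T v w
      · obtain ⟨v, hv, hvw⟩ := h
        have hgw := hgT v hv w hvw
        obtain ⟨q, hql, hq⟩ := hvw
        refine ⟨q.copy hgw.symm rfl, by simpa using hql.trans (by omega), fun z hz => ?_⟩
        rw [SimpleGraph.Walk.support_copy] at hz
        rw [hgw]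
        exact hgT v hv z ⟨q.takeUntil z hz, (q.length_takeUntil_le_length hz).trans hql,
          fun y hy => hq y (q.support_takeUntil_subset_support hz hy)⟩
      · refine ⟨(SimpleGraph.Walk.nil : G.Walk w w).copy (hgN w h).symm rfl, by simp, ?_⟩
        simp
    · have hadj : ∀ a ∈ I, ∀ b ∈ X a, a ∈ M ∧ b ∈ M ∧ ∃ y, g y = a ∧ g b = b ∧ G.Adj y b := by
        intro a ha b hb
        obtain ⟨hbM, -, y, hy, hyb⟩ := (hX a b).1 hb
        exact ⟨hm.subset (hIS ha), hbM, y, hgT a ha y hy, hgM b hbM, hyb⟩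
      rintro a b ⟨-, ⟨ha, hb⟩ | ⟨hb, ha⟩⟩
      · obtain ⟨h1, h2, y, h3, h4, h5⟩ := hadj a ha b hb
        exact ⟨h1, h2, y, b, h3, h4, h5⟩
      · obtain ⟨h1, h2, y, h3, h4, h5⟩ := hadj b hb a ha
        exact ⟨h2, h1, a, y, h4, h3, h5.symm⟩
  have hKI : I.card * (2 * (4 * c + 1) * (c * (1 + 2 * R * c)) + 1) ≤ K.edgeSet.ncard := by
    have h1 : (I.sigma X).card = ((I.sigma X).image fun e => s(e.1, e.2)).card := by
      refine (Finset.card_image_of_injOn ?_).symm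
      rintro ⟨v, x⟩ hvx ⟨w, y⟩ hwy h
      simp only [Finset.coe_sigma, Set.mem_sigma_iff, Finset.mem_coe] at hvx hwy
      rcases Sym2.eq_iff.1 h with ⟨h1, h2⟩ | ⟨h1, h2⟩
      · simp only at h1 h2
        subst h1 h2
        rfl
      · simp only at h1 h2
        exact (hXI w hwy.1 y hwy.2 (h1 ▸ hvx.1)).elim
    have h2 : (((I.sigma X).image fun e => s(e.1, e.2) : Finset (Sym2 V)) : Set (Sym2 V)) ⊆
        K.edgeSet := by
      intro z hz
      rw [Finset.mem_coe, Finset.mem_image] at hz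
      obtain ⟨⟨v, x⟩, hvx, rfl⟩ := hz
      rw [Finset.mem_sigma] at hvx
      exact ⟨((hX v x).1 hvx.2).2.1.symm, Or.inl hvx⟩
    have h3 := Set.ncard_le_ncard h2 (Set.toFinite _)
    rw [Set.ncard_coe_finset, ← h1, Finset.card_sigma] at h3
    refine le_trans ?_ h3
    rw [← smul_eq_mul]
    exact Finset.card_nsmul_le_sum _ _ _ fun v hv => hlarge v (hIS hv)
  have hM : M.card ≤ (1 + 2 * R * c) * S.card := by
    have h1 := hm.card_le
    have h2 : 2 * R * H.edgeSet.ncard ≤ 2 * R * (c * S.card) := Nat.mul_le_mul_left _ hcH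
    nlinarith
  have hIpos : 0 < I.card := by
    have := hS.card_pos
    rcases Nat.eq_zero_or_pos I.card with h | h
    · rw [h] at hIc; omega
    · exact h
  -- The bound on `X` balances `K.edgeSet.ncard ≤ c * M.card` against the bounds of `M` by `S` and
  -- of `S` by `I`.
  have hfin : I.card * (2 * (4 * c + 1) * (c * (1 + 2 * R * c)) + 1) ≤
      I.card * (2 * (4 * c + 1) * (c * (1 + 2 * R * c))) :=
    calc _ ≤ c * M.card := hKI.trans hKM
      _ ≤ c * ((1 + 2 * R * c) * S.card) := by gcongr
      _ ≤ c * ((1 + 2 * R * c) * (2 * (4 * c + 1) * I.card)) := by gcongr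
      _ = _ := by ring
  have := Nat.le_of_mul_le_mul_left hfin hIpos
  omega

/-- Weak reachability sets of bounded size for graphs with sparse shallow minors. -/
theorem exists_order_ncard_weakReach_le {V : Type u} [Finite V] {G : SimpleGraph V} {R c : ℕ}
    (hG : grad G (2 * R) ≤ c) :
    ∃ π : V → ℕ, Function.Injective π ∧ ∀ v, (weakReach G π R v).ncard ≤
      ∑ i ∈ Finset.range (R + 1), (2 * (4 * c + 1) * (c * (1 + 2 * R * c))) ^ i := by
  obtain ⟨π, hπ, hX⟩ := exists_injective_of_exists_last
    (fun (v : V) (A : Set V) => ∃ X : Finset V, X.card ≤ 2 * (4 * c + 1) * (c * (1 + 2 * R * c)) ∧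
      v ∉ X ∧ ∀ u ∈ A, ∀ p : G.Walk v u, p.length ≤ R → ∃ x ∈ X, x ∈ p.support)
    (fun S hS => by
      obtain ⟨v, hv, X, h1, h2, h3⟩ := exists_small_hitting_set hG S hS
      exact ⟨v, hv, X, h1, h2, fun u hu => h3 u hu.1 hu.2⟩)
  exact ⟨π, hπ, fun v => ncard_weakReach_le hπ hX R le_rfl v⟩

/-! ### Dimension from the colouring -/

/-- Along alternating cycles with constant signature the minima of cover walks yield an infinite
descent. -/
theorem posetDim_le_of_weakReach_coloring {P : Type u} [Finite P] [PartialOrder P] {h D : ℕ}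
    (hh : posetHeight P ≤ (h : ℕ∞)) (π : P → ℕ)
    (hπ : Function.Injective π) (φ : P → Fin D)
    (hφ : ∀ v, ∀ u ∈ weakReach (coverGraph P) π (3 * (h - 1)) v, φ u = φ v → u = v) :
    posetDim P ≤ (Fintype.card (Fin D → Prop × Prop × Prop) : ℕ∞) := by
  classical
  let W : P → Set P := weakReach (coverGraph P) π (h - 1)
  let U : Fin D → P → P → Prop := fun i a u => u ∈ W a ∧ a ≤ u ∧ φ u = i
  let B : Fin D → P → P → Prop := fun i b d => d ∈ W b ∧ d ≤ b ∧ φ d = i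
  have huniq : ∀ a, ∀ u ∈ W a, ∀ w ∈ W a, φ u = φ w → u = w := by
    have key : ∀ a, ∀ u ∈ W a, ∀ w ∈ W a, φ u = φ w → π u ≤ π w → u = w := by
      rintro a u ⟨p, hp, hpm⟩ w ⟨q, hq, hqm⟩ huw hle
      refine hφ w u ⟨q.reverse.append p, ?_, ?_⟩ huw
      · rw [SimpleGraph.Walk.length_append, SimpleGraph.Walk.length_reverse]; omega
      · intro z hz
        rw [SimpleGraph.Walk.mem_support_append_iff, SimpleGraph.Walk.support_reverse,
          List.mem_reverse] at hz
        exact hz.elim (fun hz => hle.trans (hqm z hz)) (hpm z)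
    intro a u hu w hw huw
    rcases le_total (π u) (π w) with hle | hle
    · exact key a u hu w hw huw hle
    · exact (key a w hw u hu huw.symm hle).symm
  -- If `u` or `d` precedes the walk minimum `q`, the walk from `d` via `b` and `a` to `u` has the
  -- smaller of the two as its minimum. It consists of three pieces of length at most `h - 1`, so
  -- equal colours force `u = d`.
  have hmid : ∀ a b, a ≤ b → ∃ q, U (φ q) a q ∧ B (φ q) b q ∧ ∀ u ∈ W a, ∀ d ∈ W b, φ u = φ d →
      π u < π q ∨ π d < π q → u = d := by
    intro a b hab
    obtain ⟨p, hp, hpab⟩ := exists_coverGraph_walk hh hab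
    obtain ⟨q, hq, hqmin⟩ := p.support.toFinset.exists_min_image π ⟨a, by simp⟩
    rw [List.mem_toFinset] at hq
    replace hqmin : ∀ z ∈ p.support, π q ≤ π z := fun z hz => hqmin z (List.mem_toFinset.2 hz)
    refine ⟨q, ⟨⟨p.takeUntil q hq, (p.length_takeUntil_le_length hq).trans hp, fun z hz =>
        hqmin z (p.support_takeUntil_subset_support hq hz)⟩, (hpab q hq).1, rfl⟩,
      ⟨⟨(p.dropUntil q hq).reverse, ?_, fun z hz => hqmin z ?_⟩, (hpab q hq).2, rfl⟩, ?_⟩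
    · rw [SimpleGraph.Walk.length_reverse]
      exact (p.length_dropUntil_le_length hq).trans hp
    · rw [SimpleGraph.Walk.support_reverse, List.mem_reverse] at hz
      exact p.support_dropUntil_subset_support hq hz
    · rintro u ⟨s, hs, hsm⟩ d ⟨t, ht, htm⟩ hud hlt
      have hsupp : ∀ z, z ∈ (t.reverse.append (p.reverse.append s)).support →
          z ∈ t.support ∨ z ∈ p.support ∨ z ∈ s.support := by
        intro z hz
        simpa [SimpleGraph.Walk.mem_support_append_iff] using hz
      have hlen : (t.reverse.append (p.reverse.append s)).length ≤ 3 * (h - 1) := by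
        simp only [SimpleGraph.Walk.length_append, SimpleGraph.Walk.length_reverse]; omega
      rcases le_total (π u) (π d) with hle | hle
      · refine hφ d u ⟨t.reverse.append (p.reverse.append s), hlen, fun z hz => ?_⟩ hud
        rcases hsupp z hz with hz | hz | hz
        · exact hle.trans (htm z hz)
        · have := hqmin z hz; omega
        · exact hsm z hz
      · refine (hφ u d ⟨(t.reverse.append (p.reverse.append s)).reverse, ?_, fun z hz => ?_⟩
          hud.symm).symm
        · rwa [SimpleGraph.Walk.length_reverse]
        · rw [SimpleGraph.Walk.support_reverse, List.mem_reverse] at hz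
          rcases hsupp z hz with hz | hz | hz
          · exact htm z hz
          · have := hqmin z hz; omega
          · exact hle.trans (hsm z hz)
  let σ : P × P → Fin D → Prop × Prop × Prop := fun e i =>
    ((∃ u, U i e.1 u), (∃ d, B i e.2 d), ∃ u d, U i e.1 u ∧ B i e.2 d ∧ π u < π d)
  refine posetDim_le_card_of_classes σ ?_
  intro k C hC hCne hsucc hpred
  have hCfin : C.Finite := Set.toFinite C
  -- a pair of consecutive elements whose connecting walk has the least minimum
  obtain ⟨q, ⟨e₀, he₀, e₁, he₁, hq₀, hq₁⟩, hqmin⟩ : ∃ q, (∃ e ∈ C, ∃ e' ∈ C,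
      U (φ q) e.1 q ∧ B (φ q) e'.2 q) ∧
      ∀ e ∈ C, ∀ e' ∈ C, e.1 ≤ e'.2 → ∀ u d, U (φ q) e.1 u → B (φ q) e'.2 d →
        π u < π q ∨ π d < π q → u = d := by
    let Q : Set P := {q | ∃ e ∈ C, ∃ e' ∈ C, U (φ q) e.1 q ∧ B (φ q) e'.2 q}
    have hQne : Q.Nonempty := by
      obtain ⟨e, he⟩ := hCne
      obtain ⟨e', he', hle⟩ := hsucc e he
      obtain ⟨q, h1, h2, -⟩ := hmid _ _ hle
      exact ⟨q, e, he, e', he', h1, h2⟩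
    obtain ⟨q, hq, hmin⟩ := Set.exists_min_image Q π (Set.toFinite Q) hQne
    refine ⟨q, hq, fun e he e' he' hle u d hu hd hlt => ?_⟩
    obtain ⟨q', h1, h2, h3⟩ := hmid _ _ hle
    have := hmin q' ⟨e, he, e', he', h1, h2⟩
    exact h3 u hu.1 d hd.1 (hu.2.2.trans hd.2.2.symm) (by omega)
  have hσ : ∀ e ∈ C, σ e (φ q) = k (φ q) := fun e he => congrFun (hC he).2 _
  have hU : ∀ e ∈ C, ∃ u, U (φ q) e.1 u := fun e he => by
    have : (σ e (φ q)).1 = (σ e₀ (φ q)).1 := by rw [hσ e he, hσ e₀ he₀]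
    exact this.mpr ⟨q, hq₀⟩
  have hB : ∀ e ∈ C, ∃ d, B (φ q) e.2 d := fun e he => by
    have : (σ e (φ q)).2.1 = (σ e₁ (φ q)).2.1 := by rw [hσ e he, hσ e₁ he₁]
    exact this.mpr ⟨q, hq₁⟩
  have : Nonempty P := ⟨q⟩
  choose! up hup using hU
  choose! dn hdn using hB
  have hupq : up e₀ = q := huniq _ _ (hup e₀ he₀).1 _ hq₀.1 (hup e₀ he₀).2.2
  have hdnq : dn e₁ = q := huniq _ _ (hdn e₁ he₁).1 _ hq₁.1 (hdn e₁ he₁).2.2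
  -- A common point would lie above `e.1` and below `e.2`.
  have hne : ∀ e ∈ C, up e ≠ dn e := fun e he h =>
    (hC he).1 ((hup e he).2.1.trans (h ▸ (hdn e he).2.1))
  have hlt : ∀ e ∈ C, (σ e (φ q)).2.2 ↔ π (up e) < π (dn e) := by
    intro e he
    refine ⟨?_, fun h => ⟨_, _, hup e he, hdn e he, h⟩⟩
    rintro ⟨u, d, hu, hd, h⟩
    rwa [huniq _ _ (hup e he).1 _ hu.1 ((hup e he).2.2.trans hu.2.2.symm),
      huniq _ _ (hdn e he).1 _ hd.1 ((hdn e he).2.2.trans hd.2.2.symm)]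
  by_cases hcase : (k (φ q)).2.2
  · have hall : ∀ e ∈ C, π (up e) < π (dn e) := fun e he =>
      (hlt e he).1 ((hσ e he).symm ▸ hcase)
    -- The least `up e` precedes `q`, hence equals `dn e'` for the successor `e'`; then `up e'` is
    -- smaller still. The other case is dual, with predecessors.
    obtain ⟨e, he, hmin⟩ := Set.exists_min_image C (fun e => π (up e)) hCfin hCne
    obtain ⟨e', he', hle⟩ := hsucc e he
    have h1 := hmin e₁ he₁
    have h2 := hall e₁ he₁
    rw [hdnq] at h2
    have h3 := hqmin e he e' he' hle _ _ (hup e he) (hdn e' he') (by omega)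
    have h4 := hall e' he'
    have h5 := hmin e' he'
    rw [h3] at h5
    omega
  · have hall : ∀ e ∈ C, π (dn e) < π (up e) := fun e he =>
      lt_of_le_of_ne (not_lt.1 fun h => hcase ((hσ e he) ▸ (hlt e he).2 h))
        fun h => hne e he (hπ h).symm
    obtain ⟨e, he, hmin⟩ := Set.exists_min_image C (fun e => π (dn e)) hCfin hCne
    obtain ⟨e', he', hle⟩ := hpred e he
    have h1 := hmin e₀ he₀
    have h2 := hall e₀ he₀
    rw [hupq] at h2
    have h3 := hqmin e' he' e he hle _ _ (hup e' he') (hdn e he) (by omega)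
    have h4 := hall e' he'
    have h5 := hmin e' he'
    rw [h3] at h4
    omega

theorem theorem1 (C : GraphClass.{u}) (hC : HasBoundedExpansion C) (h : ℕ) (hh : 1 ≤ h) :
    ∃ d : ℕ, ∀ (P : Type u) [Finite P] [PartialOrder P],
      posetHeight P = (h : ℕ∞) → C P (coverGraph P) → posetDim P ≤ (d : ℕ∞) := by
  obtain ⟨f, hf⟩ := hC
  -- Weak reachability is needed up to `3 * (h - 1)`, and its bound uses minors of twice that depth.
  let c := ⌈f (2 * (3 * (h - 1)))⌉₊
  let D := ∑ i ∈ Finset.range (3 * (h - 1) + 1),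
    (2 * (4 * c + 1) * (c * (1 + 2 * (3 * (h - 1)) * c))) ^ i
  refine ⟨Fintype.card (Fin (D + 1) → Prop × Prop × Prop), fun P _ _ hP hCP => ?_⟩
  obtain ⟨π, hπ, hW⟩ := exists_order_ncard_weakReach_le (R := 3 * (h - 1)) (c := c)
      ((hf _ P _ hCP).trans (Nat.le_ceil _))
  obtain ⟨φ, hφ⟩ := exists_greedy_coloring π _ hW
  refine posetDim_le_of_weakReach_coloring hP.le π hπ φ fun v u hu huv => ?_
  by_contra hne
  have hle : π u ≤ π v := by
    obtain ⟨p, -, hp⟩ := hu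
    exact hp v p.start_mem_support
  exact hφ v u hu (lt_of_le_of_ne hle fun h => hne (hπ h)) huv
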